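/- Let $R$ be a (commutative, Noetherian) Gorenstein local ring of Krull dimension one, and let $I\subseteq R$ be an ideal that contains a regular element (a nonzerodivisor of $R$) and is rigid, i.e. $\operatorname{Ext}^1_R(I,I)=0$. Let $\omega_{R/I}=\operatorname{Ext}^1_R(R/I,R)$ be the canonical module of $R/I$, and let $\lambda_R$ denote length of $R$-modules. (1) If $\lambda_R\big((I/I^2)\otimes_{R/I}\omega_{R/I}\big)\ \ge\ \lambda_R(R/I)$, then $\operatorname{End}_R(I)=R$ (that is, the homothety map $R\to\operatorname{End}_R(I)$ is bijective) and $I$ is a principal ideal. (2) If the $R/I$-module $\operatorname{Hom}_{R/I}(I/I^2,R/I)$ contains a free summand (a direct summand isomorphic to $R/I$), then likewise $\operatorname{End}_R(I)=R$ and $I$ is a principal ideal. -/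

import Mathlib

open scoped TensorProduct

universe u

/-- A commutative ring is a Gorenstein local ring if it is local, Noetherian, and has finite
injective dimension as a module over itself. -/
class IsGorensteinLocalRing (R : Type u) [CommRing R] : Prop
    extends IsLocalRing R, IsNoetherianRing R where
  exists_hasInjectiveDimensionLE :
    ∃ n : ℕ, CategoryTheory.HasInjectiveDimensionLE (ModuleCat.of R R) n

/-- An `R`-module `M` is rigid if `Ext¹_R(M, M) = 0`. -/
def IsRigidModule (R : Type u) [CommRing R] (M : Type u) [AddCommGroup M] [Module R M] : Prop :=
  Subsingleton (CategoryTheory.Abelian.Ext (ModuleCat.of R M) (ModuleCat.of R M) 1)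

/-- The `R ⧸ I`-module `Ext¹_R(R ⧸ I, R)`. When `R` is a one-dimensional Gorenstein local ring
and `I` contains a regular element, this is the canonical module `ω_{R/I}` of `R ⧸ I`. -/
def OmegaQuot {R : Type u} [CommRing R] (I : Ideal R) : Type u :=
  CategoryTheory.Abelian.Ext (ModuleCat.of R (R ⧸ I)) (ModuleCat.of R R) 1

namespace OmegaQuot

variable {R : Type u} [CommRing R] (I : Ideal R)

noncomputable instance : AddCommGroup (OmegaQuot I) :=
  inferInstanceAs (AddCommGroup
    (CategoryTheory.Abelian.Ext (ModuleCat.of R (R ⧸ I)) (ModuleCat.of R R) 1))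

noncomputable instance : Module R (OmegaQuot I) :=
  inferInstanceAs (Module R
    (CategoryTheory.Abelian.Ext (ModuleCat.of R (R ⧸ I)) (ModuleCat.of R R) 1))

/-- `Ext¹_R(R ⧸ I, R)` is annihilated by `I`. -/
theorem isTorsionBySet : Module.IsTorsionBySet R (OmegaQuot I) (I : Set R) := by
  rintro (e : CategoryTheory.Abelian.Ext (ModuleCat.of R (R ⧸ I)) (ModuleCat.of R R) 1) ⟨r, hr⟩
  change r • e = 0
  have h : r • CategoryTheory.CategoryStruct.id (ModuleCat.of R (R ⧸ I)) = 0 := by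
    refine ModuleCat.hom_ext (LinearMap.ext fun x => ?_)
    obtain ⟨y, rfl⟩ := Ideal.Quotient.mk_surjective x
    change r • Ideal.Quotient.mk I y = 0
    rw [← Ideal.Quotient.mk_eq_mk, ← Submodule.Quotient.mk_smul]
    exact (Submodule.Quotient.mk_eq_zero I).2 (I.mul_mem_right y hr)
  rw [← CategoryTheory.Abelian.Ext.mk₀_id_comp (r • e),
    CategoryTheory.Abelian.Ext.comp_smul, ← CategoryTheory.Abelian.Ext.smul_comp,
    ← CategoryTheory.Abelian.Ext.mk₀_smul, h]
  simp

/-- The induced `R ⧸ I`-module structure on `Ext¹_R(R ⧸ I, R)`. -/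
noncomputable instance : Module (R ⧸ I) (OmegaQuot I) :=
  (isTorsionBySet I).module

instance : IsScalarTower R (R ⧸ I) (OmegaQuot I) :=
  (isTorsionBySet I).isScalarTower

end OmegaQuot

/-- The twisted conormal module `(I/I²) ⊗_{R/I} ω_{R/I}`. -/
abbrev TwistedConormal {R : Type u} [CommRing R] (I : Ideal R) : Type u :=
  I.Cotangent ⊗[R ⧸ I] OmegaQuot I

/-- The `S`-module `M` has a direct summand isomorphic to `S`. For `S ≠ 0` this says
that `M` has a nonzero free direct summand. -/
def HasFreeSummand (S M : Type u) [CommRing S] [AddCommGroup M] [Module S M] : Prop :=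
  ∃ P N : Submodule S M, IsCompl P N ∧ Nonempty (P ≃ₗ[S] S)

/-! ### Connecting maps and `Ext` in the presence of a regular element. -/

section Homological

open CategoryTheory CategoryTheory.Abelian

variable {R : Type u} [CommRing R]

/-! Fix a regular `x ∈ I`, with `I` proper. Finite injective dimension makes `R ⧸ (x)` injective
relative to finite modules killed by `x`, so `Hom(-, R ⧸ (x))` is a length-preserving duality on
them (`length_hom`), and the socle of `R ⧸ (x)` has length one.

Let `T ⊆ R ⧸ (x)` be the set of classes of `f x` for `f : I → R`. As an image of `Hom(I, R)` it is
the quotient by the multiplications by elements of `R`, and it is killed by `I`, so `λ(T) ≤ λ(R ⧸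
I)`. Multiplications vanish in `Hom(I, R ⧸ I)`, and rigidity makes `Hom(I, R) → Hom(I, R ⧸ I)`
surjective; hence `T` surjects onto `Hom(I, R ⧸ I)`.

Both hypotheses give `λ(R ⧸ I) ≤ λ(Hom(I, R ⧸ I))`: the first by duality and tensor-hom adjunction
(`length_twistedConormal_le`), the second by an embedding. The surjection is then an isomorphism
(`bijective_and_isPrincipal`). An endomorphism of `I` is zero in `Hom(I, R ⧸ I)`, hence zero in `T`,
hence a multiplication. Moreover `Hom(I, R ⧸ I) ≅ T` has socle of length at most one, while the dual
of `I ⧸ 𝔪I` embeds in that socle; Nakayama makes `I` principal. -/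

/-- The short exact sequence `0 → R → R → R ⧸ (x) → 0` given by multiplication by `x`. -/
noncomputable abbrev mulShortComplex (x : R) : ShortComplex (ModuleCat.{u} R) :=
  ModuleCat.shortComplexOfCompEqZero (LinearMap.mulLeft R x) (Ideal.span {x}).mkQ <| by
    ext
    simp

theorem mulShortComplex_shortExact {x : R} (hx : x ∈ nonZeroDivisors R) :
    (mulShortComplex x).ShortExact := by
  refine ModuleCat.shortComplex_shortExact _ ?_ ?_ (Submodule.mkQ_surjective _)
  · intro y
    change (Ideal.span {x}).mkQ y = 0 ↔ y ∈ Set.range fun r : R => x * r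
    rw [Submodule.mkQ_apply, Submodule.Quotient.mk_eq_zero, Ideal.mem_span_singleton']
    simp [mul_comm]
  · intro a b h
    have h2 : x * a = x * b := h
    exact sub_eq_zero.1 ((mem_nonZeroDivisors_iff.1 hx).1 _ (by linear_combination h2))

theorem mk₀_mulLeft_eq_smul (x : R) :
    (Ext.mk₀ (mulShortComplex x).f : Ext (ModuleCat.of R R) (ModuleCat.of R R) 0) =
      x • Ext.mk₀ (𝟙 (ModuleCat.of R R)) := by
  rw [← Ext.mk₀_smul]
  congr 1

theorem ext_smul_eq_zero {M N : Type u} [AddCommGroup M] [Module R M] [AddCommGroup N]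
    [Module R N] {x : R} (hM : ∀ m : M, x • m = 0) {n : ℕ}
    (e : Ext (ModuleCat.of R M) (ModuleCat.of R N) n) : x • e = 0 := by
  have h : x • 𝟙 (ModuleCat.of R M) = 0 :=
    ModuleCat.hom_ext (LinearMap.ext fun m => hM m)
  rw [← Ext.mk₀_id_comp (x • e), Ext.comp_smul, ← Ext.smul_comp, ← Ext.mk₀_smul, h]
  simp

/-- The connecting homomorphism `Hom(M, R ⧸ (x)) → Ext¹(M, R)`. -/
noncomputable def homQuotToExt {x : R} (hx : x ∈ nonZeroDivisors R)
    (M : Type u) [AddCommGroup M] [Module R M] :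
    (M →ₗ[R] R ⧸ Ideal.span {x}) →ₗ[R] Ext (ModuleCat.of R M) (ModuleCat.of R R) 1 where
  toFun f := (Ext.mk₀ (ModuleCat.ofHom f)).comp (mulShortComplex_shortExact hx).extClass
    (zero_add 1)
  map_add' f g := by rw [ModuleCat.ofHom_add, Ext.mk₀_add, Ext.add_comp]
  map_smul' r f := by
    rw [show ModuleCat.ofHom (r • f) = r • ModuleCat.ofHom f from rfl, Ext.mk₀_smul,
      Ext.smul_comp, RingHom.id_apply]

/-- The kernel comes from `Hom(M, R)`, which is zero because `x` kills `M` and is regular on `R`. -/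
theorem homQuotToExt_injective {x : R} (hx : x ∈ nonZeroDivisors R)
    {M : Type u} [AddCommGroup M] [Module R M] (hM : ∀ m : M, x • m = 0) :
    Function.Injective (homQuotToExt hx M) := by
  rw [injective_iff_map_eq_zero]
  intro f hf
  obtain ⟨g, hg⟩ := Ext.covariant_sequence_exact₃ _ (mulShortComplex_shortExact hx)
    (Ext.mk₀ (ModuleCat.ofHom f)) (zero_add 1) hf
  obtain ⟨g, rfl⟩ := Ext.homEquiv₀.symm.surjective g
  have hg0 : g = 0 := by
    ext m
    have h1 : x * g.hom m = 0 := by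
      rw [← smul_eq_mul, ← map_smul, hM, map_zero]
    exact (mem_nonZeroDivisors_iff.1 hx).1 _ h1
  subst hg0
  have h2 : ModuleCat.ofHom f = 0 := by
    rw [← Ext.mk₀_eq_zero_iff, ← hg]
    simp
  simpa using congrArg ModuleCat.Hom.hom h2

/-- The next map in the long exact sequence is multiplication by `x` on `Ext¹(M, R)`, which is zero
since `x` kills `M`. -/
theorem homQuotToExt_surjective {x : R} (hx : x ∈ nonZeroDivisors R)
    {M : Type u} [AddCommGroup M] [Module R M] (hM : ∀ m : M, x • m = 0) :
    Function.Surjective (homQuotToExt hx M) := by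
  intro e
  obtain ⟨f, hf⟩ := Ext.covariant_sequence_exact₁ _ (mulShortComplex_shortExact hx) e (by
    rw [mk₀_mulLeft_eq_smul, Ext.comp_smul, ext_smul_eq_zero hM]) (zero_add 1)
  obtain ⟨f, rfl⟩ := Ext.homEquiv₀.symm.surjective f
  exact ⟨f.hom, hf⟩

/-- The Rees isomorphism `Hom(M, R ⧸ (x)) ≃ Ext¹(M, R)` for a regular element `x` killing `M`. -/
noncomputable def homQuotEquivExt {x : R} (hx : x ∈ nonZeroDivisors R)
    {M : Type u} [AddCommGroup M] [Module R M] (hM : ∀ m : M, x • m = 0) :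
    (M →ₗ[R] R ⧸ Ideal.span {x}) ≃ₗ[R] Ext (ModuleCat.of R M) (ModuleCat.of R R) 1 :=
  LinearEquiv.ofBijective (homQuotToExt hx M)
    ⟨homQuotToExt_injective hx hM, homQuotToExt_surjective hx hM⟩

theorem homQuotToExt_comp {x : R} (hx : x ∈ nonZeroDivisors R)
    {M N : Type u} [AddCommGroup M] [Module R M] [AddCommGroup N] [Module R N]
    (f : N →ₗ[R] R ⧸ Ideal.span {x}) (i : M →ₗ[R] N) :
    homQuotToExt hx M (f ∘ₗ i) =
      (Ext.mk₀ (ModuleCat.ofHom i)).comp (homQuotToExt hx N f) (zero_add 1) := by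
  simp [homQuotToExt, ModuleCat.ofHom_comp]

/-- The short complex of modules attached to an exact pair of linear maps. -/
noncomputable abbrev exactShortComplex {M N P : Type u} [AddCommGroup M] [Module R M]
    [AddCommGroup N] [Module R N] [AddCommGroup P] [Module R P] {f : M →ₗ[R] N} {g : N →ₗ[R] P}
    (h : Function.Exact f g) : ShortComplex (ModuleCat.{u} R) :=
  ModuleCat.shortComplexOfCompEqZero f g h.linearMap_comp_eq_zero

theorem exactShortComplex_shortExact {M N P : Type u} [AddCommGroup M] [Module R M]
    [AddCommGroup N] [Module R N] [AddCommGroup P] [Module R P] {f : M →ₗ[R] N} {g : N →ₗ[R] P}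
    (h : Function.Exact f g) (hf : Function.Injective f) (hg : Function.Surjective g) :
    (exactShortComplex h).ShortExact :=
  ModuleCat.shortComplex_shortExact _ h hf hg

/-- Multiplication by `x` gives a free resolution of length one. -/
theorem ext_quot_span_singleton_eq_zero {x : R} (hx : x ∈ nonZeroDivisors R)
    (N : ModuleCat.{u} R) (n : ℕ)
    (e : Ext (ModuleCat.of R (R ⧸ Ideal.span {x})) N (n + 2)) : e = 0 := by
  obtain ⟨d, rfl⟩ := Ext.contravariant_sequence_exact₃ (mulShortComplex_shortExact hx) N e
    (Ext.eq_zero_of_projective (P := ModuleCat.of R R) _) (by lia : 1 + (n + 1) = n + 2)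
  rw [Ext.eq_zero_of_projective (P := ModuleCat.of R R) d, Ext.comp_zero]

/-- Lifting along a surjection when the obstruction in `Ext¹` vanishes. -/
theorem exists_comp_eq_of_subsingleton_ext {L M N P : Type u} [AddCommGroup L] [Module R L]
    [AddCommGroup M] [Module R M] [AddCommGroup N] [Module R N] [AddCommGroup P] [Module R P]
    {f : M →ₗ[R] N} {g : N →ₗ[R] P}
    (h : Function.Exact f g) (hf : Function.Injective f) (hg : Function.Surjective g)
    (hL : Subsingleton (Ext (ModuleCat.of R L) (ModuleCat.of R M) 1)) (φ : L →ₗ[R] P) :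
    ∃ ψ : L →ₗ[R] N, g ∘ₗ ψ = φ := by
  obtain ⟨ψ, hψ⟩ := Ext.covariant_sequence_exact₃ _ (exactShortComplex_shortExact h hf hg)
    (Ext.mk₀ (ModuleCat.ofHom φ)) (zero_add 1) (hL.elim _ _)
  obtain ⟨ψ, rfl⟩ := Ext.homEquiv₀.symm.surjective ψ
  refine ⟨ψ.hom, ?_⟩
  have h2 : ψ ≫ ModuleCat.ofHom g = ModuleCat.ofHom φ := by
    apply (Ext.mk₀_bijective _ _).1
    rw [← hψ, ← Ext.mk₀_comp_mk₀]
    rfl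
  simpa using congrArg ModuleCat.Hom.hom h2

end Homological

/-! ### Vanishing of higher `Ext` and self-injectivity of `R ⧸ (x)`. -/

section Duality

open CategoryTheory CategoryTheory.Abelian IsLocalRing

variable {R : Type u} [CommRing R]

theorem smul_quot_span_singleton {x : R} (m : R ⧸ Ideal.span {x}) : x • m = 0 := by
  obtain ⟨r, rfl⟩ := Ideal.Quotient.mk_surjective m
  rw [Algebra.smul_def, Ideal.Quotient.algebraMap_eq, ← map_mul, Ideal.Quotient.eq_zero_iff_mem]
  exact Ideal.mul_mem_right _ _ (Ideal.mem_span_singleton_self x)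

variable [IsLocalRing R]

/-- In a one-dimensional local ring the maximal ideal is the only prime containing a given
regular element. -/
theorem eq_maximalIdeal_of_mem_nonZeroDivisors (hdim : ringKrullDim R = 1) {x : R}
    (hx : x ∈ nonZeroDivisors R) (p : Ideal R) [hp : p.IsPrime] (hxp : x ∈ p) :
    p = maximalIdeal R := by
  have : Ring.KrullDimLE 1 R := by
    rw [Ring.KrullDimLE, Order.krullDimLE_iff]
    exact hdim.le
  rcases Ring.krullDimLE_one_iff.1 this p hp with h | h
  · exact absurd hx (notMem_nonZeroDivisors_of_mem_mem_minimalPrimes hxp h)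
  · exact IsLocalRing.eq_maximalIdeal h

theorem nontrivial_quot_span_singleton {x : R} (hxm : x ∈ maximalIdeal R) :
    Nontrivial (R ⧸ Ideal.span {x}) := by
  rw [Ideal.Quotient.nontrivial_iff, Ne, Ideal.span_singleton_eq_top]
  exact hxm

variable [IsNoetherianRing R]

/-- Dévissage: finite modules killed by an element `x` that lies in no non-maximal prime are
iterated extensions of copies of the residue field. -/
theorem induction_of_smul_eq_zero {x : R}
    (hprime : ∀ p : Ideal R, p.IsPrime → x ∈ p → p = maximalIdeal R)
    {motive : (N : Type u) → [AddCommGroup N] → [Module R N] → Prop}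
    (subsingleton : ∀ (N : Type u) [AddCommGroup N] [Module R N] [Subsingleton N], motive N)
    (residue : ∀ (N : Type u) [AddCommGroup N] [Module R N] [Module.Finite R N],
      (∀ m : N, x • m = 0) → (N ≃ₗ[R] R ⧸ maximalIdeal R) → motive N)
    (exact : ∀ (N₁ : Type u) [AddCommGroup N₁] [Module R N₁]
      (N₂ : Type u) [AddCommGroup N₂] [Module R N₂] [Module.Finite R N₂]
      (N₃ : Type u) [AddCommGroup N₃] [Module R N₃] [Module.Finite R N₃]
      (f : N₁ →ₗ[R] N₂) (g : N₂ →ₗ[R] N₃), (∀ m : N₂, x • m = 0) → (∀ m : N₃, x • m = 0) →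
      Function.Injective f → Function.Surjective g → Function.Exact f g →
      motive N₁ → motive N₃ → motive N₂)
    (M : Type u) [AddCommGroup M] [Module R M] [hfin : Module.Finite R M]
    (hM : ∀ m : M, x • m = 0) : motive M := by
  refine IsNoetherianRing.induction_on_isQuotientEquivQuotientPrime R hfin
    (motive := fun N _ _ _ => (∀ m : N, x • m = 0) → motive N) ?_ ?_ ?_ hM
  · intro N _ _ _ _ _
    exact subsingleton N
  · intro N _ _ _ p e hN
    have hxp : x ∈ p.1 := by
      have h := hN (e.symm (Ideal.Quotient.mk p.1 1))
      rw [← map_smul, LinearEquiv.map_eq_zero_iff] at h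
      rw [← Ideal.Quotient.eq_zero_iff_mem, ← h, Algebra.smul_def]
      simp
    have hp := hprime p.1 p.2 hxp
    exact residue N hN (hp ▸ e)
  · intro N₁ _ _ _ N₂ _ _ _ N₃ _ _ _ f g hf hg hfg h₁ h₃ hN
    have hN₃ : ∀ m : N₃, x • m = 0 := by
      intro m
      obtain ⟨m, rfl⟩ := hg m
      rw [← map_smul, hN, map_zero]
    refine exact N₁ N₂ N₃ f g hN hN₃ hf hg hfg (h₁ fun m => hf ?_) (h₃ hN₃)
    rw [map_smul, hN, map_zero]

/-- An associated prime of `T` contains `x`, so it is the maximal ideal. -/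
theorem exists_injective_residue {x : R}
    (hprime : ∀ p : Ideal R, p.IsPrime → x ∈ p → p = maximalIdeal R)
    (T : Type u) [AddCommGroup T] [Module R T] [Nontrivial T] (hT : ∀ m : T, x • m = 0) :
    ∃ f : (R ⧸ maximalIdeal R) →ₗ[R] T, Function.Injective f := by
  obtain ⟨p, hp⟩ := associatedPrimes.nonempty R T
  rw [AssociatedPrimes.mem_iff, isAssociatedPrime_iff_exists_injective_linearMap] at hp
  obtain ⟨hpp, f, hf⟩ := hp
  have hxp : x ∈ p := by
    have h := hT (f (Ideal.Quotient.mk p 1))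
    rw [← map_smul] at h
    rw [← Ideal.Quotient.eq_zero_iff_mem, ← hf (h.trans (map_zero f).symm), Algebra.smul_def]
    simp
  obtain rfl := hprime p hpp hxp
  exact ⟨f, hf⟩

/-- Higher `Ext` into a Gorenstein ring vanishes on finite modules killed by a regular element
lying in no non-maximal prime. -/
theorem ext_eq_zero_of_smul_eq_zero {x : R} (hx : x ∈ nonZeroDivisors R)
    (hxm : x ∈ maximalIdeal R)
    (hprime : ∀ p : Ideal R, p.IsPrime → x ∈ p → p = maximalIdeal R)
    {n : ℕ} (hn : HasInjectiveDimensionLE (ModuleCat.of R R) n) (k : ℕ)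
    (M : Type u) [AddCommGroup M] [Module R M] [Module.Finite R M] (hM : ∀ m : M, x • m = 0)
    (e : Ext (ModuleCat.of R M) (ModuleCat.of R R) (k + 2)) : e = 0 := by
  -- Descending induction on the degree: `j` bounds how far `k` lies below `n`, and at `j = 0` the
  -- degree `k + 2` exceeds the injective dimension.
  suffices H : ∀ j k : ℕ, n ≤ k + j → ∀ (M : Type u) [AddCommGroup M] [Module R M]
      [Module.Finite R M] (_ : ∀ m : M, x • m = 0)
      (e : Ext (ModuleCat.of R M) (ModuleCat.of R R) (k + 2)), e = 0 from
    H n k (by lia) M hM e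
  clear e hM
  intro j
  induction j with
  | zero =>
    intro k hk M _ _ _ _ e
    have := HasInjectiveDimensionLT.subsingleton (ModuleCat.of R R) (n + 1) (k + 2) (by lia)
      (ModuleCat.of R M)
    exact Subsingleton.elim _ _
  | succ j ih =>
    intro k hk M _ _ _ hM
    refine induction_of_smul_eq_zero hprime
      (motive := fun M _ _ => ∀ e : Ext (ModuleCat.of R M) (ModuleCat.of R R) (k + 2), e = 0)
      ?_ ?_ ?_ M hM
    · intro N _ _ _ e
      have h : 𝟙 (ModuleCat.of R N) = 0 :=
        ModuleCat.hom_ext (LinearMap.ext fun m => Subsingleton.elim _ _)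
      rw [← Ext.mk₀_id_comp e, h]
      simp
    · intro N _ _ _ hN i e
      have := nontrivial_quot_span_singleton hxm
      -- Embed the residue field in `R ⧸ (x)`: its `Ext` sits between that of `R ⧸ (x)`, zero in
      -- degrees at least two, and that of the cokernel one degree higher, zero by induction.
      obtain ⟨f, hf⟩ := exists_injective_residue hprime (R ⧸ Ideal.span {x})
        smul_quot_span_singleton
      have hex := LinearMap.exact_map_mkQ_range (f ∘ₗ i.toLinearMap)
      have hS := exactShortComplex_shortExact hex (hf.comp i.injective)
        (Submodule.mkQ_surjective _)
      obtain ⟨d, rfl⟩ := Ext.contravariant_sequence_exact₁ hS _ e (by lia : 1 + (k + 2) = k + 1 + 2)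
        (ih (k + 1) (by lia) _ (by
          intro m
          obtain ⟨m, rfl⟩ := Submodule.mkQ_surjective _ m
          rw [← map_smul, smul_quot_span_singleton, map_zero]) _)
      rw [ext_quot_span_singleton_eq_zero hx _ _ d, Ext.comp_zero]
    · intro N₁ _ _ N₂ _ _ _ N₃ _ _ _ f g _ _ hf hg hfg h₁ h₃ e
      obtain ⟨d, rfl⟩ := Ext.contravariant_sequence_exact₂
        (exactShortComplex_shortExact hfg hf hg) _ e (h₁ _)
      rw [h₃ d, Ext.comp_zero]

/-- The self-injectivity of `R ⧸ (x)`, for a Gorenstein ring `R` and finite modules killed by the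
regular element `x`. -/
theorem exists_extend_to_quot {x : R} (hx : x ∈ nonZeroDivisors R) (hxm : x ∈ maximalIdeal R)
    (hprime : ∀ p : Ideal R, p.IsPrime → x ∈ p → p = maximalIdeal R)
    {n : ℕ} (hn : HasInjectiveDimensionLE (ModuleCat.of R R) n)
    {M N : Type u} [AddCommGroup M] [Module R M] [AddCommGroup N] [Module R N]
    [Module.Finite R N] (hN : ∀ m : N, x • m = 0) {i : M →ₗ[R] N} (hi : Function.Injective i)
    (f : M →ₗ[R] R ⧸ Ideal.span {x}) : ∃ g : N →ₗ[R] R ⧸ Ideal.span {x}, g ∘ₗ i = f := by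
  have hM : ∀ m : M, x • m = 0 := fun m => hi (by rw [map_smul, hN, map_zero])
  have hex := LinearMap.exact_map_mkQ_range i
  have hS := exactShortComplex_shortExact hex hi (Submodule.mkQ_surjective _)
  -- Under the Rees isomorphism, the obstruction to extending `f` lies in `Ext²(N ⧸ M, R) = 0`.
  obtain ⟨e, he⟩ := Ext.contravariant_sequence_exact₁ hS _ (homQuotToExt hx M f)
    (by lia : 1 + 1 = 0 + 2)
    (ext_eq_zero_of_smul_eq_zero hx hxm hprime hn 0 _ (by
      intro m
      obtain ⟨m, rfl⟩ := Submodule.mkQ_surjective _ m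
      rw [← map_smul, hN, map_zero]) _)
  obtain ⟨g, rfl⟩ := homQuotToExt_surjective hx hN e
  refine ⟨g, homQuotToExt_injective hx hM ?_⟩
  rw [homQuotToExt_comp, ← he]

/-- A regular element `x` of a local ring `R`, contained in the maximal ideal and in no other prime,
such that `R ⧸ (x)` is injective relative to finite modules killed by `x`. -/
structure IsGorensteinParameter (x : R) : Prop where
  mem_nonZeroDivisors : x ∈ nonZeroDivisors R
  mem_maximalIdeal : x ∈ maximalIdeal R
  eq_maximalIdeal : ∀ p : Ideal R, p.IsPrime → x ∈ p → p = maximalIdeal R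
  exists_extend : ∀ {M N : Type u} [AddCommGroup M] [Module R M] [AddCommGroup N] [Module R N]
    [Module.Finite R N], (∀ m : N, x • m = 0) → ∀ {i : M →ₗ[R] N}, Function.Injective i →
    ∀ f : M →ₗ[R] R ⧸ Ideal.span {x}, ∃ g : N →ₗ[R] R ⧸ Ideal.span {x}, g ∘ₗ i = f

end Duality

theorem IsGorensteinLocalRing.isGorensteinParameter {R : Type u} [CommRing R]
    [IsGorensteinLocalRing R] (hdim : ringKrullDim R = 1) {x : R} (hx : x ∈ nonZeroDivisors R)
    (hxm : x ∈ IsLocalRing.maximalIdeal R) :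
    IsGorensteinParameter x := by
  have hprime : ∀ p : Ideal R, p.IsPrime → x ∈ p → p = IsLocalRing.maximalIdeal R :=
    fun p _ => eq_maximalIdeal_of_mem_nonZeroDivisors hdim hx p
  obtain ⟨n, hn⟩ := IsGorensteinLocalRing.exists_hasInjectiveDimensionLE (R := R)
  exact ⟨hx, hxm, hprime, fun hN _ hi f => exists_extend_to_quot hx hxm hprime hn hN hi f⟩

/-! ### Length and duality with values in `R ⧸ (x)`. -/

section GorensteinDuality

open IsLocalRing

section

variable {R : Type u} [CommRing R]

theorem Module.injective_of_surjective_of_length_le {M N : Type u} [AddCommGroup M] [Module R M]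
    [AddCommGroup N] [Module R N] {f : M →ₗ[R] N} (hf : Function.Surjective f)
    (hle : Module.length R M ≤ Module.length R N) (hN : Module.length R N ≠ ⊤) :
    Function.Injective f := by
  have h := Module.length_eq_add_of_exact (LinearMap.ker f).subtype f
    (Submodule.subtype_injective _) hf (LinearMap.exact_subtype_ker_map f)
  rw [h] at hle
  have h0 : Module.length R (LinearMap.ker f) = 0 := by
    have h1 : Module.length R (LinearMap.ker f) + Module.length R N ≤ 0 + Module.length R N := by
      rwa [zero_add]
    exact le_antisymm ((ENat.add_le_add_iff_right hN).1 h1) bot_le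
  rw [Module.length_eq_zero_iff] at h0
  rw [← LinearMap.ker_eq_bot]
  exact (Submodule.subsingleton_iff_eq_bot).1 h0

/-- Evaluation at `1` on `Hom(R ⧸ J, N)`. -/
noncomputable abbrev evalOne (J : Ideal R) (N : Type u) [AddCommGroup N] [Module R N] :
    ((R ⧸ J) →ₗ[R] N) →ₗ[R] N :=
  LinearMap.applyₗ (1 : R ⧸ J)

theorem evalOne_injective (J : Ideal R) (N : Type u) [AddCommGroup N] [Module R N] :
    Function.Injective (evalOne J N) := by
  intro f g h
  refine LinearMap.ext fun a => ?_
  obtain ⟨r, rfl⟩ := Ideal.Quotient.mk_surjective a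
  have h1 : f 1 = g 1 := h
  have h2 : Ideal.Quotient.mk J r = r • (1 : R ⧸ J) := by simp [Algebra.smul_def]
  rw [h2, map_smul, map_smul, h1]

theorem mem_range_evalOne {J : Ideal R} {N : Type u} [AddCommGroup N] [Module R N] {b : N} :
    b ∈ LinearMap.range (evalOne J N) ↔ ∀ r ∈ J, r • b = 0 := by
  constructor
  · rintro ⟨f, rfl⟩ r hr
    change r • f 1 = 0
    rw [← map_smul, show r • (1 : R ⧸ J) = 0 by
      rw [Algebra.smul_def, mul_one, Ideal.Quotient.algebraMap_eq]
      exact Ideal.Quotient.eq_zero_iff_mem.2 hr, map_zero]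
  · intro h
    have hle : J ≤ LinearMap.ker (LinearMap.toSpanSingleton R N b) := fun r hr => h r hr
    refine ⟨Submodule.liftQ J _ hle, ?_⟩
    change Submodule.liftQ J _ hle (Submodule.Quotient.mk 1) = b
    rw [Submodule.liftQ_apply, LinearMap.toSpanSingleton_apply, one_smul]

theorem length_range_evalOne (J : Ideal R) (N : Type u) [AddCommGroup N] [Module R N] :
    Module.length R (LinearMap.range (evalOne J N)) = Module.length R ((R ⧸ J) →ₗ[R] N) :=
  (LinearEquiv.ofInjective _ (evalOne_injective J N)).length_eq.symm

theorem smul_quotient_eq_zero {x : R} {I : Ideal R} (hxI : x ∈ I) (a : R ⧸ I) : x • a = 0 := by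
  obtain ⟨r, rfl⟩ := Ideal.Quotient.mk_surjective a
  rw [Algebra.smul_def, Ideal.Quotient.algebraMap_eq, Ideal.Quotient.eq_zero_iff_mem.2 hxI,
    zero_mul]

theorem smul_hom_eq_zero {x : R} {M N : Type u} [AddCommGroup M] [Module R M] [AddCommGroup N]
    [Module R N] (hM : ∀ m : M, x • m = 0) (f : M →ₗ[R] N) : x • f = 0 :=
  LinearMap.ext fun m => by
    rw [LinearMap.smul_apply, ← map_smul, hM, map_zero, LinearMap.zero_apply]

theorem finite_hom_quotient [IsNoetherianRing R] {x : R} (I : Ideal R) :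
    Module.Finite R ((R ⧸ I) →ₗ[R] R ⧸ Ideal.span {x}) :=
  Module.Finite.of_injective _ (evalOne_injective I (R ⧸ Ideal.span {x}))

theorem length_eq_one_of_equiv_residue [IsLocalRing R] {N : Type u} [AddCommGroup N] [Module R N]
    (e : N ≃ₗ[R] R ⧸ maximalIdeal R) : Module.length R N = 1 :=
  Module.length_eq_one_iff.2 (isSimpleModule_iff_quot_maximal.2 ⟨_, inferInstance, ⟨e⟩⟩)

end

variable {R : Type u} [CommRing R] [IsLocalRing R] [IsNoetherianRing R] {x : R}

namespace IsGorensteinParameter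

theorem length_ne_top (hx : IsGorensteinParameter x) (M : Type u) [AddCommGroup M] [Module R M]
    [Module.Finite R M] (hM : ∀ m : M, x • m = 0) : Module.length R M ≠ ⊤ := by
  refine induction_of_smul_eq_zero hx.eq_maximalIdeal
    (motive := fun M _ _ => Module.length R M ≠ ⊤) ?_ ?_ ?_ M hM
  · intro N _ _ _
    simp
  · intro N _ _ _ _ e
    rw [length_eq_one_of_equiv_residue e]
    exact ENat.one_ne_top
  · intro N₁ _ _ N₂ _ _ _ N₃ _ _ _ f g _ _ hf hg hfg h₁ h₃
    rw [Module.length_eq_add_of_exact f g hf hg hfg]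
    exact WithTop.add_ne_top.2 ⟨h₁, h₃⟩

/-- By relative injectivity the dual is exact, so both sides are additive and dévissage reduces to
the residue field. The factor is shown to be one afterwards. -/
theorem length_hom_eq_mul (hx : IsGorensteinParameter x) (M : Type u) [AddCommGroup M] [Module R M]
    [Module.Finite R M] (hM : ∀ m : M, x • m = 0) :
    Module.length R (M →ₗ[R] R ⧸ Ideal.span {x}) =
      Module.length R ((R ⧸ maximalIdeal R) →ₗ[R] R ⧸ Ideal.span {x}) * Module.length R M := by
  refine induction_of_smul_eq_zero hx.eq_maximalIdeal
    (motive := fun M _ _ => Module.length R (M →ₗ[R] R ⧸ Ideal.span {x}) =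
      Module.length R ((R ⧸ maximalIdeal R) →ₗ[R] R ⧸ Ideal.span {x}) * Module.length R M)
      ?_ ?_ ?_ M hM
  · intro N _ _ _
    simp
  · intro N _ _ _ _ e
    rw [length_eq_one_of_equiv_residue e, mul_one]
    exact (LinearEquiv.congrLeft (R ⧸ Ideal.span {x}) R e).length_eq
  · intro N₁ _ _ N₂ _ _ _ N₃ _ _ _ f g hN₂ _ hf hg hfg h₁ h₃
    rw [Module.length_eq_add_of_exact f g hf hg hfg, mul_add, ← h₁, ← h₃, add_comm]
    refine Module.length_eq_add_of_exact (LinearMap.lcomp R _ g) (LinearMap.lcomp R _ f) ?_ ?_ ?_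
    · intro a b hab
      exact LinearMap.ext fun n => by
        obtain ⟨n, rfl⟩ := hg n
        exact LinearMap.congr_fun hab n
    · intro a
      exact hx.exists_extend hN₂ hf a
    · intro a
      constructor
      · intro ha
        have hker : LinearMap.ker g ≤ LinearMap.ker a := by
          intro n hn
          obtain ⟨n, rfl⟩ := (hfg n).1 hn
          exact LinearMap.congr_fun ha n
        refine ⟨(LinearMap.ker g).liftQ a hker ∘ₗ (g.quotKerEquivOfSurjective hg).symm, ?_⟩
        refine LinearMap.ext fun n => ?_
        have h : (g.quotKerEquivOfSurjective hg).symm (g n) = Submodule.Quotient.mk n := by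
          rw [LinearEquiv.symm_apply_eq]
          rfl
        change (LinearMap.ker g).liftQ a hker ((g.quotKerEquivOfSurjective hg).symm (g n)) = a n
        rw [h, Submodule.liftQ_apply]
      · rintro ⟨b, rfl⟩
        refine LinearMap.ext fun n => ?_
        change b (g (f n)) = 0
        rw [hfg.apply_apply_eq_zero, map_zero]

/-- `R ⧸ (x)` is its own dual, so its finite nonzero length `l` satisfies `l = t * l`. -/
theorem length_hom_residue (hx : IsGorensteinParameter x) :
    Module.length R ((R ⧸ maximalIdeal R) →ₗ[R] R ⧸ Ideal.span {x}) = 1 := by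
  have := nontrivial_quot_span_singleton hx.mem_maximalIdeal
  have h := hx.length_hom_eq_mul (R ⧸ Ideal.span {x}) smul_quot_span_singleton
  have hfin := hx.length_ne_top (R ⧸ Ideal.span {x}) smul_quot_span_singleton
  have hpos : Module.length R (R ⧸ Ideal.span {x}) ≠ 0 := Module.length_pos.ne'
  have hself : Module.length R ((R ⧸ Ideal.span {x}) →ₗ[R] R ⧸ Ideal.span {x}) =
      Module.length R (R ⧸ Ideal.span {x}) := by
    rw [← length_range_evalOne]
    have htop : LinearMap.range (evalOne (Ideal.span {x}) (R ⧸ Ideal.span {x})) = ⊤ := by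
      rw [eq_top_iff]
      intro b _
      rw [mem_range_evalOne]
      intro r hr
      obtain ⟨s, rfl⟩ := Ideal.mem_span_singleton'.1 hr
      rw [mul_smul, smul_quot_span_singleton, smul_zero]
    rw [htop, Module.length_top]
  rw [hself] at h
  generalize Module.length R ((R ⧸ maximalIdeal R) →ₗ[R] R ⧸ Ideal.span {x}) = t at h
  generalize Module.length R (R ⧸ Ideal.span {x}) = l at h hfin hpos
  lift l to ℕ using hfin
  cases t with
  | top => simp [ENat.top_mul hpos] at h
  | coe t =>
    norm_cast at *
    exact Nat.eq_of_mul_eq_mul_right (Nat.pos_of_ne_zero hpos) (by lia)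

/-- The duality `Hom(-, R ⧸ (x))` preserves length. -/
theorem length_hom (hx : IsGorensteinParameter x) (M : Type u) [AddCommGroup M] [Module R M]
    [Module.Finite R M] (hM : ∀ m : M, x • m = 0) :
    Module.length R (M →ₗ[R] R ⧸ Ideal.span {x}) = Module.length R M := by
  rw [hx.length_hom_eq_mul M hM, hx.length_hom_residue, one_mul]

theorem length_le_one_of_injective (hx : IsGorensteinParameter x) {T : Type u} [AddCommGroup T]
    [Module R T] (hT : ∀ r ∈ maximalIdeal R, ∀ t : T, r • t = 0)
    {g : T →ₗ[R] R ⧸ Ideal.span {x}} (hg : Function.Injective g) : Module.length R T ≤ 1 := by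
  have hle : LinearMap.range g ≤
      LinearMap.range (evalOne (maximalIdeal R) (R ⧸ Ideal.span {x})) := by
    rintro _ ⟨t, rfl⟩
    rw [mem_range_evalOne]
    intro r hr
    rw [← map_smul, hT r hr, map_zero]
  rw [(LinearEquiv.ofInjective g hg).length_eq, ← hx.length_hom_residue, ← length_range_evalOne]
  exact Module.length_le_of_injective (Submodule.inclusion hle) (Submodule.inclusion_injective hle)

/-- Biduality for `R ⧸ I`. -/
theorem bijective_applyₗ_quotient (hx : IsGorensteinParameter x) {I : Ideal R} (hxI : x ∈ I) :
    Function.Bijective (LinearMap.applyₗ :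
      (R ⧸ I) →ₗ[R] ((R ⧸ I) →ₗ[R] R ⧸ Ideal.span {x}) →ₗ[R] R ⧸ Ideal.span {x}) := by
  have := finite_hom_quotient (x := x) I
  have hsurj : Function.Surjective (LinearMap.applyₗ :
      (R ⧸ I) →ₗ[R] ((R ⧸ I) →ₗ[R] R ⧸ Ideal.span {x}) →ₗ[R] R ⧸ Ideal.span {x}) := by
    intro φ
    -- View the dual of `R ⧸ I` inside `R ⧸ (x)` by evaluation at `1`. The functional `φ` extends to
    -- an endomorphism of `R ⧸ (x)`, which is multiplication by some `r`.
    obtain ⟨ψ, hψ⟩ := hx.exists_extend smul_quot_span_singleton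
      (evalOne_injective I (R ⧸ Ideal.span {x})) φ
    obtain ⟨r, hr⟩ := Ideal.Quotient.mk_surjective (ψ 1)
    refine ⟨Ideal.Quotient.mk I r, LinearMap.ext fun f => ?_⟩
    rw [← hψ]
    obtain ⟨s, hs⟩ := Ideal.Quotient.mk_surjective (f 1)
    have h1 (J : Ideal R) (a : R) : Ideal.Quotient.mk J a = a • (1 : R ⧸ J) := by
      simp [Algebra.smul_def]
    change f (Ideal.Quotient.mk I r) = ψ (f 1)
    rw [h1 I r, map_smul, ← hs, h1 _ s, map_smul, ← hr, h1 _ r, smul_comm]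
  refine ⟨Module.injective_of_surjective_of_length_le hsurj ?_ ?_, hsurj⟩
  all_goals rw [hx.length_hom _ fun f => smul_hom_eq_zero (smul_quotient_eq_zero hxI) f,
    hx.length_hom _ (smul_quotient_eq_zero hxI)]
  exact hx.length_ne_top _ (smul_quotient_eq_zero hxI)

/-- Maps from `M` land in the socle of `R ⧸ (x)`, a copy of the residue field, which also embeds in
`A`. -/
theorem exists_injective_hom_hom (hx : IsGorensteinParameter x) {M A : Type u} [AddCommGroup M]
    [Module R M] [AddCommGroup A] [Module R A] [Nontrivial A]
    (hM : ∀ r ∈ maximalIdeal R, ∀ m : M, r • m = 0) (hA : ∀ a : A, x • a = 0) :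
    ∃ f : (M →ₗ[R] R ⧸ Ideal.span {x}) →ₗ[R] M →ₗ[R] A, Function.Injective f := by
  let S := LinearMap.range (evalOne (maximalIdeal R) (R ⧸ Ideal.span {x}))
  have hS : IsSimpleModule R S := by
    rw [← Module.length_eq_one_iff, length_range_evalOne, hx.length_hom_residue]
  obtain ⟨n, hn, ⟨e⟩⟩ := isSimpleModule_iff_quot_maximal.1 hS
  obtain rfl := IsLocalRing.eq_maximalIdeal hn
  obtain ⟨j, hj⟩ := exists_injective_residue hx.eq_maximalIdeal A hA
  have hmem (g : M →ₗ[R] R ⧸ Ideal.span {x}) (m : M) : g m ∈ S :=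
    mem_range_evalOne.2 fun r hr => by rw [← map_smul, hM r hr, map_zero]
  refine ⟨{ toFun := fun g => j ∘ₗ e.toLinearMap ∘ₗ g.codRestrict S (hmem g)
            map_add' := fun g h => ?_
            map_smul' := fun r g => ?_ }, ?_⟩
  · rw [← LinearMap.comp_add, ← LinearMap.comp_add]
    rfl
  · rw [RingHom.id_apply, ← LinearMap.comp_smul, ← LinearMap.comp_smul]
    rfl
  · intro g h hgh
    refine LinearMap.ext fun m => ?_
    have h1 := e.injective (hj (LinearMap.congr_fun hgh m))
    exact congrArg Subtype.val h1

end IsGorensteinParameter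

end GorensteinDuality

/-! ### Rigid ideals: comparing `Hom(I, R)` with `Hom(I, R ⧸ I)`. -/

section RigidIdeals

open IsLocalRing

section

variable {R : Type u} [CommRing R] {I : Ideal R} {x : R}

/-- For `x ∈ I`, the map `Hom(I, R) → R ⧸ (x)` sending `f` to the class of `f x`. Its kernel is
the image of `R`, so its image is isomorphic to `Ext¹(R ⧸ I, R)`. -/
noncomputable def evalMod (hxI : x ∈ I) : (I →ₗ[R] R) →ₗ[R] R ⧸ Ideal.span {x} :=
  (Ideal.span {x}).mkQ ∘ₗ LinearMap.applyₗ (⟨x, hxI⟩ : I)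

/-- From `x * f i = i * f x` and `f x = r * x`, cancel `x`. -/
theorem evalMod_eq_zero (hx : x ∈ nonZeroDivisors R) (hxI : x ∈ I) {f : I →ₗ[R] R}
    (hf : evalMod hxI f = 0) : ∃ r : R, ∀ i : I, f i = r * i := by
  change (Ideal.span {x}).mkQ (f ⟨x, hxI⟩) = 0 at hf
  rw [Submodule.mkQ_apply, Submodule.Quotient.mk_eq_zero, Ideal.mem_span_singleton'] at hf
  obtain ⟨r, hr⟩ := hf
  refine ⟨r, fun i => ?_⟩
  have h1 : x * f i = i * f ⟨x, hxI⟩ := by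
    rw [← smul_eq_mul, ← map_smul, ← smul_eq_mul, ← map_smul]
    congr 1
    ext
    simp [mul_comm]
  rw [← hr] at h1
  refine sub_eq_zero.1 ((mem_nonZeroDivisors_iff.1 hx).1 _ ?_)
  linear_combination h1

theorem smul_evalMod (hxI : x ∈ I) (f : I →ₗ[R] R) {r : R} (hr : r ∈ I) :
    r • evalMod hxI f = 0 := by
  have h1 : r • f ⟨x, hxI⟩ = x • f ⟨r, hr⟩ := by
    rw [← map_smul, ← map_smul]
    congr 1
    ext
    simp [mul_comm]
  change r • (Ideal.span {x}).mkQ (f ⟨x, hxI⟩) = 0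
  rw [← map_smul, h1, map_smul]
  exact smul_quot_span_singleton _

theorem bijective_algebraMap_end (hx : x ∈ nonZeroDivisors R) (hxI : x ∈ I)
    (h : ∀ φ : Module.End R I, evalMod hxI (I.subtype ∘ₗ φ) = 0) :
    Function.Bijective (algebraMap R (Module.End R I)) := by
  constructor
  · intro a b hab
    have h1 := congrArg Subtype.val (LinearMap.congr_fun hab ⟨x, hxI⟩)
    have h2 : a * x = b * x := h1
    refine sub_eq_zero.1 ((mem_nonZeroDivisors_iff.1 hx).2 _ ?_)
    linear_combination h2
  · intro φ
    obtain ⟨r, hr⟩ := evalMod_eq_zero hx hxI (h φ)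
    exact ⟨r, LinearMap.ext fun i => Subtype.ext (hr i).symm⟩

theorem bijective_algebraMap_end_top :
    Function.Bijective (algebraMap R (Module.End R (⊤ : Ideal R))) := by
  refine bijective_algebraMap_end (x := 1) (one_mem _) Submodule.mem_top fun φ => ?_
  change (Ideal.span {(1 : R)}).mkQ _ = 0
  rw [Submodule.mkQ_apply, Submodule.Quotient.mk_eq_zero, Ideal.span_singleton_one]
  exact Submodule.mem_top

theorem length_hom_cotangent_le :
    Module.length R (I.Cotangent →ₗ[R ⧸ I] R ⧸ I) ≤ Module.length R (I →ₗ[R] R ⧸ I) := by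
  let F : (I.Cotangent →ₗ[R ⧸ I] R ⧸ I) →ₗ[R] (I →ₗ[R] R ⧸ I) :=
    { toFun := fun f => f.restrictScalars R ∘ₗ I.toCotangent
      map_add' := fun _ _ => rfl
      map_smul' := fun _ _ => rfl }
  refine Module.length_le_of_injective F fun f g h => LinearMap.ext fun c => ?_
  obtain ⟨i, rfl⟩ := I.toCotangent_surjective c
  exact LinearMap.congr_fun h i

theorem HasFreeSummand.length_le (h : HasFreeSummand (R ⧸ I) (I.Cotangent →ₗ[R ⧸ I] R ⧸ I)) :
    Module.length R (R ⧸ I) ≤ Module.length R (I →ₗ[R] R ⧸ I) := by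
  obtain ⟨P, -, -, ⟨e⟩⟩ := h
  refine le_trans ?_ length_hom_cotangent_le
  exact Module.length_le_of_injective ((P.subtype ∘ₗ e.symm.toLinearMap).restrictScalars R)
    (P.injective_subtype.comp e.symm.injective)

end

variable {R : Type u} [CommRing R] [IsLocalRing R] [IsNoetherianRing R] {I : Ideal R} {x : R}

/-- Nakayama: an ideal `I` for which `I ⧸ 𝔪I` has length at most one is principal. -/
theorem isPrincipal_of_length_le_one
    (h : Module.length R (I ⧸ (maximalIdeal R • ⊤ : Submodule R I)) ≤ 1) : I.IsPrincipal := by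
  obtain ⟨y, hy⟩ : ∃ y : I, Submodule.span R
      {(maximalIdeal R • ⊤ : Submodule R I).mkQ y} = ⊤ := by
    rcases Order.le_one_iff.1 h with h | h
    · rw [Module.length_eq_zero_iff] at h
      exact ⟨0, Subsingleton.elim _ _⟩
    · rw [Module.length_eq_one_iff] at h
      have := IsSimpleModule.nontrivial R (I ⧸ (maximalIdeal R • ⊤ : Submodule R I))
      obtain ⟨z, hz⟩ := exists_ne (0 : I ⧸ (maximalIdeal R • ⊤ : Submodule R I))
      obtain ⟨y, rfl⟩ := Submodule.mkQ_surjective _ z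
      exact ⟨y, IsSimpleModule.span_singleton_eq_top R hz⟩
  have htop : Submodule.span R {y} = ⊤ := by
    rw [eq_top_iff]
    refine Submodule.le_of_le_smul_of_le_jacobson_bot (I := maximalIdeal R)
      (IsNoetherian.noetherian _) (IsLocalRing.maximalIdeal_le_jacobson _) ?_
    rw [← Set.image_singleton, ← Submodule.map_span] at hy
    have h1 := congrArg (Submodule.comap (maximalIdeal R • ⊤ : Submodule R I).mkQ) hy
    rw [Submodule.comap_map_eq, Submodule.ker_mkQ, Submodule.comap_top] at h1
    exact h1.ge
  refine ⟨⟨y, ?_⟩⟩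
  have h2 := congrArg (Submodule.map I.subtype) htop
  rw [Submodule.map_span, Set.image_singleton, Submodule.map_top, Submodule.range_subtype] at h2
  exact h2.symm

namespace IsGorensteinParameter

theorem bijective_and_isPrincipal (hx : IsGorensteinParameter x) (hxI : x ∈ I) (hI : I ≠ ⊤)
    (hlift : ∀ φ : I →ₗ[R] R ⧸ I, ∃ ψ : I →ₗ[R] R, I.mkQ ∘ₗ ψ = φ)
    (hle : Module.length R (R ⧸ I) ≤ Module.length R (I →ₗ[R] R ⧸ I)) :
    Function.Bijective (algebraMap R (Module.End R I)) ∧ I.IsPrincipal := by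
  have hA : ∀ a : R ⧸ I, x • a = 0 := smul_quotient_eq_zero hxI
  have : Nontrivial (R ⧸ I) := Ideal.Quotient.nontrivial_iff.2 hI
  let T := LinearMap.range (evalMod hxI)
  let π : (I →ₗ[R] R) →ₗ[R] I →ₗ[R] R ⧸ I := LinearMap.compRight R I.mkQ
  have hker : LinearMap.ker (evalMod hxI) ≤ LinearMap.ker π := by
    intro f hf
    obtain ⟨r, hr⟩ := evalMod_eq_zero hx.mem_nonZeroDivisors hxI hf
    refine LinearMap.ext fun i => ?_
    change I.mkQ (f i) = 0
    rw [hr i, Submodule.mkQ_apply, Submodule.Quotient.mk_eq_zero]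
    exact I.mul_mem_left _ i.2
  -- Reduction modulo `I` factors through `T`, since it kills multiplications by ring elements.
  let σ : T →ₗ[R] I →ₗ[R] R ⧸ I :=
    (LinearMap.ker (evalMod hxI)).liftQ π hker ∘ₗ (evalMod hxI).quotKerEquivRange.symm.toLinearMap
  have hσ (f : I →ₗ[R] R) : σ ⟨evalMod hxI f, f, rfl⟩ = π f := by
    have h : (evalMod hxI).quotKerEquivRange.symm ⟨evalMod hxI f, f, rfl⟩ =
        Submodule.Quotient.mk f := by
      rw [LinearEquiv.symm_apply_eq]
      rfl
    change (LinearMap.ker (evalMod hxI)).liftQ π hker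
      ((evalMod hxI).quotKerEquivRange.symm ⟨evalMod hxI f, f, rfl⟩) = π f
    rw [h, Submodule.liftQ_apply]
  have hσ_surj : Function.Surjective σ := by
    intro φ
    obtain ⟨ψ, hψ⟩ := hlift φ
    exact ⟨_, (hσ ψ).trans hψ⟩
  have hT : T ≤ LinearMap.range (evalOne I (R ⧸ Ideal.span {x})) := by
    rintro _ ⟨f, rfl⟩
    exact mem_range_evalOne.2 fun r hr => smul_evalMod hxI f hr
  have hTlen : Module.length R T ≤ Module.length R (R ⧸ I) := by
    rw [← hx.length_hom _ hA, ← length_range_evalOne]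
    exact Module.length_le_of_injective (Submodule.inclusion hT) (Submodule.inclusion_injective hT)
  have hσ_inj : Function.Injective σ :=
    Module.injective_of_surjective_of_length_le hσ_surj (hTlen.trans hle) <| ne_top_of_le_ne_top
      (hx.length_ne_top _ hA) ((Module.length_le_of_surjective σ hσ_surj).trans hTlen)
  refine ⟨bijective_algebraMap_end hx.mem_nonZeroDivisors hxI fun φ => ?_,
    isPrincipal_of_length_le_one ?_⟩
  · have h0 : σ ⟨evalMod hxI (I.subtype ∘ₗ φ), _, rfl⟩ = 0 := by
      rw [hσ]
      refine LinearMap.ext fun i => ?_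
      change I.mkQ (φ i) = 0
      rw [Submodule.mkQ_apply, Submodule.Quotient.mk_eq_zero]
      exact (φ i).2
    exact congrArg Subtype.val (hσ_inj (h0.trans (map_zero σ).symm))
  · have hM : ∀ r ∈ maximalIdeal R,
        ∀ m : I ⧸ (maximalIdeal R • ⊤ : Submodule R I), r • m = 0 := by
      intro r hr m
      obtain ⟨m, rfl⟩ := Submodule.mkQ_surjective _ m
      rw [← map_smul, Submodule.mkQ_apply, Submodule.Quotient.mk_eq_zero]
      exact Submodule.smul_mem_smul hr Submodule.mem_top
    obtain ⟨F, hF⟩ := hx.exists_injective_hom_hom hM hA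
    -- Pass to the dual of `I ⧸ 𝔪I`, which embeds in `R ⧸ (x)` via `Hom(I ⧸ 𝔪I, R ⧸ I)`, `Hom(I, R ⧸
    -- I)` and `T`. It is killed by `𝔪`, so its length is at most one.
    rw [← hx.length_hom _ fun m => hM x hx.mem_maximalIdeal m]
    have hcomp : Function.Injective
        (LinearMap.lcomp R (R ⧸ I) (maximalIdeal R • ⊤ : Submodule R I).mkQ) := by
      intro f g h
      refine LinearMap.ext fun m => ?_
      obtain ⟨m, rfl⟩ := Submodule.mkQ_surjective _ m
      exact LinearMap.congr_fun h m
    let e := LinearEquiv.ofBijective σ ⟨hσ_inj, hσ_surj⟩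
    refine hx.length_le_one_of_injective (fun r hr f => LinearMap.ext fun m => ?_)
      (g := T.subtype ∘ₗ e.symm.toLinearMap ∘ₗ
        LinearMap.lcomp R _ (maximalIdeal R • ⊤ : Submodule R I).mkQ ∘ₗ F) ?_
    · rw [LinearMap.smul_apply, ← map_smul, hM r hr, map_zero, LinearMap.zero_apply]
    · exact T.injective_subtype.comp (e.symm.injective.comp (hcomp.comp hF))

/-- With `ω` the dual of `R ⧸ I`, the module is a quotient of `I ⊗ ω`, whose dual is `Hom(I, Hom(ω,
R ⧸ (x)))` by adjunction, that is `Hom(I, R ⧸ I)` by biduality. -/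
theorem length_twistedConormal_le (hx : IsGorensteinParameter x) (hxI : x ∈ I) :
    Module.length R (TwistedConormal I) ≤ Module.length R (I →ₗ[R] R ⧸ I) := by
  have hA : ∀ a : R ⧸ I, x • a = 0 := smul_quotient_eq_zero hxI
  have := finite_hom_quotient (x := x) I
  let e : ((R ⧸ I) →ₗ[R] R ⧸ Ideal.span {x}) ≃ₗ[R] OmegaQuot I :=
    homQuotEquivExt hx.mem_nonZeroDivisors hA
  let F : I ⊗[R] ((R ⧸ I) →ₗ[R] R ⧸ Ideal.span {x}) →ₗ[R] TwistedConormal I :=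
    TensorProduct.lift <| LinearMap.mk₂ R (fun i w => I.toCotangent i ⊗ₜ[R ⧸ I] e w)
      (fun i j w => by rw [map_add, TensorProduct.add_tmul])
      (fun r i w => by rw [map_smul, TensorProduct.smul_tmul'])
      (fun i w v => by rw [map_add, TensorProduct.tmul_add])
      (fun r i w => by rw [map_smul, TensorProduct.tmul_smul])
  have hF : Function.Surjective F := by
    intro t
    induction t using TensorProduct.induction_on with
    | zero => exact ⟨0, map_zero F⟩
    | tmul c w =>
      obtain ⟨i, rfl⟩ := I.toCotangent_surjective c
      obtain ⟨w, rfl⟩ := e.surjective w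
      exact ⟨i ⊗ₜ w, rfl⟩
    | add s t hs ht =>
      obtain ⟨s, rfl⟩ := hs
      obtain ⟨t, rfl⟩ := ht
      exact ⟨s + t, map_add F s t⟩
  have hkill (t : I ⊗[R] ((R ⧸ I) →ₗ[R] R ⧸ Ideal.span {x})) : x • t = 0 := by
    induction t using TensorProduct.induction_on with
    | zero => exact smul_zero x
    | tmul i w => rw [← TensorProduct.tmul_smul, smul_hom_eq_zero hA, TensorProduct.tmul_zero]
    | add s t hs ht => rw [smul_add, hs, ht, add_zero]
  refine (Module.length_le_of_surjective F hF).trans ?_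
  let adj : (I →ₗ[R] ((R ⧸ I) →ₗ[R] R ⧸ Ideal.span {x}) →ₗ[R] R ⧸ Ideal.span {x}) ≃ₗ[R]
      (I ⊗[R] ((R ⧸ I) →ₗ[R] R ⧸ Ideal.span {x}) →ₗ[R] R ⧸ Ideal.span {x}) :=
    TensorProduct.lift.equiv (RingHom.id R) _ _ _
  have hadj : Module.length R
        (I →ₗ[R] ((R ⧸ I) →ₗ[R] R ⧸ Ideal.span {x}) →ₗ[R] R ⧸ Ideal.span {x}) =
      Module.length R (I ⊗[R] ((R ⧸ I) →ₗ[R] R ⧸ Ideal.span {x}) →ₗ[R] R ⧸ Ideal.span {x}) :=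
    LinearEquiv.length_eq adj
  rw [← hx.length_hom _ hkill, ← hadj]
  exact (LinearEquiv.congrRight
    (LinearEquiv.ofBijective _ (hx.bijective_applyₗ_quotient hxI))).length_eq.ge

end IsGorensteinParameter

end RigidIdeals

theorem corollary5p2 {R : Type u} [CommRing R] [IsGorensteinLocalRing R]
    (hdim : ringKrullDim R = 1) (I : Ideal R)
    (hreg : ∃ x ∈ I, x ∈ nonZeroDivisors R) (hrigid : IsRigidModule R I) :
    (Module.length R (R ⧸ I) ≤ Module.length R (TwistedConormal I) →
      Function.Bijective (algebraMap R (Module.End R I)) ∧ I.IsPrincipal) ∧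
    (HasFreeSummand (R ⧸ I) (I.Cotangent →ₗ[R ⧸ I] R ⧸ I) →
      Function.Bijective (algebraMap R (Module.End R I)) ∧ I.IsPrincipal) := by
  -- The unit ideal is separate: the duality needs `x` in the maximal ideal, and the socle argument
  -- needs `R ⧸ I` nonzero.
  rcases eq_or_ne I ⊤ with rfl | hI
  · have h : Function.Bijective (algebraMap R (Module.End R (⊤ : Ideal R))) ∧
        (⊤ : Ideal R).IsPrincipal := ⟨bijective_algebraMap_end_top, top_isPrincipal⟩
    exact ⟨fun _ => h, fun _ => h⟩
  · obtain ⟨x, hxI, hx⟩ := hreg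
    have hpar := IsGorensteinLocalRing.isGorensteinParameter hdim hx
      (IsLocalRing.le_maximalIdeal hI hxI)
    have hlift : ∀ φ : I →ₗ[R] R ⧸ I, ∃ ψ : I →ₗ[R] R, I.mkQ ∘ₗ ψ = φ :=
      exists_comp_eq_of_subsingleton_ext (LinearMap.exact_subtype_mkQ I) I.injective_subtype
        I.mkQ_surjective hrigid
    exact ⟨fun h => hpar.bijective_and_isPrincipal hxI hI hlift
        (h.trans (hpar.length_twistedConormal_le hxI)),
      fun h => hpar.bijective_and_isPrincipal hxI hI hlift h.length_le⟩
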